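/- Write $S^1=\mathbb{R}/2\pi\mathbb{Z}$. For $n\ge 0$ let $C^n(S^1;E)$ be the Banach space of $n$ times continuously differentiable maps $f\colon S^1\to E$ with norm $\max_{i\le n}\sup_\varphi\lVert f^{(i)}(\varphi)\rVert$, and write $\dot\gamma$ for the derivative of $\gamma$ with respect to $\varphi\in S^1$. Let $\mathrm{Diff}^k(S^1)$ be the group of $C^k$-diffeomorphisms of $S^1$ (homeomorphisms if $k=0$). A map $P$ from an open subset of a normed space $X$ into $\mathrm{Diff}^k(S^1)$ is called $\ell$ times continuously Fréchet differentiable if, near each point $x_0$ of its domain, $P(x)(\varphi)=P(x_0)(\varphi)+U(x)(\varphi)\bmod 2\pi$ with a map $U$ into $C^k(S^1;\mathbb{R})$ that is $\ell$ times continuously Fréchet differentiable near $x_0$ and satisfies $U(x_0)=0$; its derivative at $x_0$ is then $U'(x_0)\colon X\to C^k(S^1;\mathbb{R})$. Let $k\ge 0$ and $\ell\ge 1$ be integers, let $r>0$ and $R>r/2$, and let $\gamma_0(\varphi)=(R\cos\varphi,R\sin\varphi)$. Then there exists an open neighborhood $\mathcal{V}\subset C^{k+\ell+1}(S^1;\mathbb{R}^2)$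 of $\gamma_0$ such that the following hold. 1. For each $\gamma\in\mathcal{V}$ and $\varphi\in S^1$ the circle of radius $r$ centered at $\gamma(\varphi)$ intersects the curve $\gamma$ in exactly two points $\gamma(p_\gamma(\varphi))\ne\gamma(m_\gamma(\varphi))$, and $p_\gamma(\varphi)$, $m_\gamma(\varphi)$ are the only parameters $\psi\in S^1$ with $\lvert\gamma(\psi)-\gamma(\varphi)\rvert=r$. Here $p_\gamma(\varphi)$ is the next such parameter after $\varphi$, and $m_\gamma(\varphi)$ is the previous such parameter before $\varphi$, with respect to the positive orientation of $S^1$. 2. For each $\gamma\in\mathcal{V}$ the maps $p_\gamma$ and $m_\gamma$ belong to $\mathrm{Diff}^k(S^1)$, and the mappings $\gamma\mapsto p_\gamma$ and $\gamma\mapsto m_\gamma$ from $\mathcal{V}$ to $\mathrm{Diff}^k(S^1)$ are $\ell$ times continuously Fréchet differentiable. Their first derivatives at $\gamma\in\mathcal{V}$ in direction $\sigma\in C^{k+\ell+1}(S^1;\mathbb{R}^2)$ are given, for every $\varphi\in S^1$, by $$p_\gamma'(\sigma)(\varphi)=\frac{\langle\sigma(\varphi)-\sigma(p_\gamma(\varphi)),\,\gamma(p_\gamma(\varphi))-\gamma(\varphi)\rangle}{\langle\dot\gamma(p_\gamma(\varphi)),\,\gamma(p_\gamma(\varphi))-\gamma(\varphi)\rangle},\qquad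 m_\gamma'(\sigma)(\varphi)=\frac{\langle\sigma(\varphi)-\sigma(m_\gamma(\varphi)),\,\gamma(m_\gamma(\varphi))-\gamma(\varphi)\rangle}{\langle\dot\gamma(m_\gamma(\varphi)),\,\gamma(m_\gamma(\varphi))-\gamma(\varphi)\rangle},$$ where both denominators are nonzero. -/

import Mathlib

open Set Filter Topology

noncomputable section

namespace CircInv

/-- The circle `S¹ = ℝ / 2πℤ`. -/
abbrev S1 : Type := AddCircle (2 * Real.pi)

/-- The Euclidean plane. -/
abbrev Plane : Type := EuclideanSpace ℝ (Fin 2)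

instance factTwoPi : Fact ((0 : ℝ) < 2 * Real.pi) := ⟨Real.two_pi_pos⟩

section FunctionSpace

variable (n : ℕ) (E : Type*) [NormedAddCommGroup E] [NormedSpace ℝ E]

/-- The functions `f : S¹ → E` that are `n` times continuously differentiable in the angle. -/
def ckSubmodule : Submodule ℝ (S1 → E) where
  carrier := {f | ContDiff ℝ n (fun x : ℝ => f (x : S1))}
  add_mem' := by
    intro f g hf hg
    rw [mem_ofPred_eq] at hf hg ⊢
    exact hf.add hg
  zero_mem' := by
    rw [mem_ofPred_eq]
    exact contDiff_const
  smul_mem' := by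
    intro c f hf
    rw [mem_ofPred_eq] at hf ⊢
    exact contDiff_const.smul hf

/-- The space `Cⁿ(S¹; E)`; its norm is defined below. -/
def Ck : Type _ := ↥(ckSubmodule n E)

instance : AddCommGroup (Ck n E) := inferInstanceAs (AddCommGroup ↥(ckSubmodule n E))

instance : Module ℝ (Ck n E) := inferInstanceAs (Module ℝ ↥(ckSubmodule n E))

instance : CoeFun (Ck n E) (fun _ => S1 → E) := ⟨fun f => f.1⟩

variable {n E}

theorem Ck.contDiff (f : Ck n E) : ContDiff ℝ n (fun x : ℝ => f (x : S1)) := f.2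

theorem periodic_iteratedDeriv (f : S1 → E) (i : ℕ) :
    Function.Periodic (iteratedDeriv i (fun x : ℝ => f (x : S1))) (2 * Real.pi) := by
  intro x
  have h : (fun z : ℝ => f ((z + 2 * Real.pi : ℝ) : S1)) = fun z : ℝ => f (z : S1) := by
    funext z
    rw [AddCircle.coe_add_period]
  have h2 := congrFun (iteratedDeriv_comp_add_const i (fun z : ℝ => f (z : S1)) (2 * Real.pi)) x
  rw [h] at h2
  exact h2.symm

/-- The `i`-th derivative of `f : S¹ → E` with respect to the angle, as a function on `S¹`. -/
def angDeriv (i : ℕ) (f : S1 → E) : S1 → E := (periodic_iteratedDeriv f i).lift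

theorem angDeriv_coe (i : ℕ) (f : S1 → E) (x : ℝ) :
    angDeriv i f (x : S1) = iteratedDeriv i (fun y : ℝ => f (y : S1)) x :=
  Function.Periodic.lift_coe _ x

theorem continuous_angDeriv (f : Ck n E) {i : ℕ} (hi : i ≤ n) : Continuous (angDeriv i f) := by
  have h : Continuous (iteratedDeriv i (fun x : ℝ => f (x : S1))) :=
    ContDiff.continuous_iteratedDeriv i f.contDiff (by exact_mod_cast hi)
  exact continuous_coinduced_dom.mpr (h.congr fun x => (angDeriv_coe i f x).symm)

variable (n E)

/-- The tuple `(f, f', …, f⁽ⁿ⁾)` of continuous functions on the circle. -/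
def jet : Ck n E →ₗ[ℝ] (Fin (n + 1) → C(S1, E)) where
  toFun f := fun i => ⟨angDeriv i f, continuous_angDeriv f (Nat.lt_succ_iff.mp i.2)⟩
  map_add' f g := by
    funext i
    ext φ
    induction φ using QuotientAddGroup.induction_on with
    | H x =>
      have hi : (i : ℕ) ≤ n := Nat.lt_succ_iff.mp i.2
      have hf : ContDiffAt ℝ (i : ℕ) (fun x : ℝ => f (x : S1)) x :=
        (f.contDiff.of_le (by exact_mod_cast hi)).contDiffAt
      have hg : ContDiffAt ℝ (i : ℕ) (fun x : ℝ => g (x : S1)) x :=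
        (g.contDiff.of_le (by exact_mod_cast hi)).contDiffAt
      change angDeriv i (f + g) (x : S1) = angDeriv i f (x : S1) + angDeriv i g (x : S1)
      rw [angDeriv_coe, angDeriv_coe, angDeriv_coe]
      exact iteratedDeriv_fun_add hf hg
  map_smul' c f := by
    funext i
    ext φ
    induction φ using QuotientAddGroup.induction_on with
    | H x =>
      have hi : (i : ℕ) ≤ n := Nat.lt_succ_iff.mp i.2
      have hf : ContDiffAt ℝ (i : ℕ) (fun x : ℝ => f (x : S1)) x :=
        (f.contDiff.of_le (by exact_mod_cast hi)).contDiffAt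
      change angDeriv i (c • f) (x : S1) = c • angDeriv i f (x : S1)
      rw [angDeriv_coe, angDeriv_coe]
      exact iteratedDeriv_fun_const_smul hf c

theorem jet_injective : Function.Injective (jet n E) := by
  intro f g h
  apply Subtype.ext
  funext φ
  induction φ using QuotientAddGroup.induction_on with
  | H x =>
    have h1 : angDeriv 0 f (x : S1) = angDeriv 0 g (x : S1) :=
      DFunLike.congr_fun (congrFun h 0) (x : S1)
    rw [angDeriv_coe, angDeriv_coe, iteratedDeriv_zero, iteratedDeriv_zero] at h1
    exact h1

/-- The `Cⁿ` norm `‖f‖ = max_{i ≤ n} sup_φ ‖f⁽ⁱ⁾(φ)‖`. -/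
instance : NormedAddCommGroup (Ck n E) :=
  NormedAddCommGroup.induced (Ck n E) (Fin (n + 1) → C(S1, E)) (jet n E) (jet_injective n E)

instance : NormedSpace ℝ (Ck n E) :=
  NormedSpace.induced ℝ (Ck n E) (Fin (n + 1) → C(S1, E)) (jet n E)

variable {n E}

theorem Ck.norm_le_iff (f : Ck n E) {C : ℝ} (hC : 0 ≤ C) :
    ‖f‖ ≤ C ↔ ∀ i ≤ n, ∀ φ : S1, ‖angDeriv i f φ‖ ≤ C := by
  change ‖jet n E f‖ ≤ C ↔ _
  rw [pi_norm_le_iff_of_nonneg hC]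
  constructor
  · intro h i hi φ
    exact (ContinuousMap.norm_le _ hC).mp (h ⟨i, Nat.lt_succ_iff.mpr hi⟩) φ
  · intro h i
    exact (ContinuousMap.norm_le _ hC).mpr (h i (Nat.lt_succ_iff.mp i.2))

end FunctionSpace

/-- The circle of radius `R` about the origin with constant speed parameterization,
`φ ↦ (R cos φ, R sin φ)`. -/
def circleFun (R : ℝ) : S1 → Plane :=
  Function.Periodic.lift (f := fun x : ℝ => (!₂[R * Real.cos x, R * Real.sin x] : Plane))
    (c := 2 * Real.pi) (fun x => by simp [Real.cos_add_two_pi, Real.sin_add_two_pi])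

theorem circleFun_contDiff (R : ℝ) (n : ℕ) :
    ContDiff ℝ n (fun x : ℝ => circleFun R (x : S1)) := by
  have h : (fun x : ℝ => circleFun R (x : S1)) =
      fun x : ℝ => (!₂[R * Real.cos x, R * Real.sin x] : Plane) := by
    funext x
    exact Function.Periodic.lift_coe _ x
  rw [h, contDiff_euclidean]
  intro i
  fin_cases i
  · exact contDiff_const.mul Real.contDiff_cos
  · exact contDiff_const.mul Real.contDiff_sin

/-- The circle of radius `R` as an element of `Cⁿ(S¹; ℝ²)`. -/
def circleCurve (n : ℕ) (R : ℝ) : Ck n Plane := ⟨circleFun R, circleFun_contDiff R n⟩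

/-- A map `S¹ → S¹` is of class `Cᵏ` if it has a lift `ℝ → ℝ` of class `Cᵏ`. -/
def IsCkMap (k : ℕ) (g : S1 → S1) : Prop :=
  ∃ G : ℝ → ℝ, ContDiff ℝ k G ∧ ∀ x : ℝ, g (x : S1) = (G x : S1)

/-- `Diffᵏ(S¹)`: bijections of the circle that are of class `Cᵏ` together with their inverse
(homeomorphisms for `k = 0`). -/
structure Diff (k : ℕ) where
  toEquiv : S1 ≃ S1
  isCk : IsCkMap k toEquiv
  isCk_symm : IsCkMap k toEquiv.symm

instance (k : ℕ) : CoeFun (Diff k) (fun _ => S1 → S1) := ⟨fun g => g.toEquiv⟩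

section Differentiability

variable {X : Type*} [NormedAddCommGroup X] [NormedSpace ℝ X] {k : ℕ}

/-- `Diffᵏ(S¹)` is viewed inside the Banach manifold `Cᵏ(S¹, S¹)`, modelled on `Cᵏ(S¹; ℝ)`. The
inverse of the chart centred at `g` is `u ↦ (φ ↦ g φ + u φ mod 2π)`, for small `u`.
`IsLocalRep P x₀ U` says that `U` is, near `x₀`, the map `P` read in the chart centred at `P x₀`. -/
def IsLocalRep (P : X → Diff k) (x₀ : X) (U : X → Ck k ℝ) : Prop :=
  U x₀ = 0 ∧ ∀ᶠ x in 𝓝 x₀, ∀ φ : S1, P x φ = P x₀ φ + ((U x φ : ℝ) : S1)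

/-- `P` is `ℓ` times continuously Fréchet differentiable near `x₀`. -/
def DiffContDiffAt (ℓ : ℕ) (P : X → Diff k) (x₀ : X) : Prop :=
  ∃ U : X → Ck k ℝ, IsLocalRep P x₀ U ∧ ContDiffAt ℝ ℓ U x₀

/-- `P` has the Fréchet derivative `P'` at `x₀`, where tangent vectors to `Diffᵏ(S¹)` are
identified with elements of `Cᵏ(S¹; ℝ)` through the charts above. -/
def DiffHasFDerivAt (P : X → Diff k) (P' : X →L[ℝ] Ck k ℝ) (x₀ : X) : Prop :=
  ∃ U : X → Ck k ℝ, IsLocalRep P x₀ U ∧ HasFDerivAt U P' x₀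

end Differentiability

/-- `ψ` is the next parameter after `φ`, in the positive direction, at which the curve `γ` meets
the circle of radius `r` about `γ φ`. -/
def IsNextParam (γ : S1 → Plane) (r : ℝ) (φ ψ : S1) : Prop :=
  ∃ t ∈ Ioo 0 (2 * Real.pi), ψ = φ + ((t : ℝ) : S1) ∧ dist (γ ψ) (γ φ) = r ∧
    ∀ s ∈ Ioo 0 t, dist (γ (φ + ((s : ℝ) : S1))) (γ φ) ≠ r

/-- `ψ` is the previous parameter before `φ`, at which the curve `γ` meets
the circle of radius `r` about `γ φ`. -/
def IsPrevParam (γ : S1 → Plane) (r : ℝ) (φ ψ : S1) : Prop :=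
  ∃ t ∈ Ioo 0 (2 * Real.pi), ψ = φ - ((t : ℝ) : S1) ∧ dist (γ ψ) (γ φ) = r ∧
    ∀ s ∈ Ioo 0 t, dist (γ (φ - ((s : ℝ) : S1))) (γ φ) ≠ r

end CircInv

end

/-!
Write the parameters on the circle about `γ φ` as `φ + a φ` with a real displacement `a`. The
equation `|γ (φ + a φ) - γ φ|² = r²` is of class `C^ℓ` in `(γ, a) ∈ C^(k+ℓ+1) × C^k`, because every
derivative of the composition `(γ, a) ↦ γ ∘ (id + a)` costs one derivative of `γ`. Its partial
derivative in `a` is multiplication by twice the radial speed `⟨γ' ψ, γ ψ - γ φ⟩` at `ψ = φ + a φ`,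
which is invertible as long as the radial speed does not vanish. The implicit function theorem
therefore yields displacements depending on `γ` in a `C^ℓ` manner, and differentiating the equation
yields the formula for their derivatives.

No further intersections appear for nearby curves: by compactness the distance stays away from `r`
off the two branches, and near a branch Rolle's theorem would produce a zero of the radial speed
between two solutions. Since the distance is symmetric, the next intersection seen from `φ` sees `φ`
as its previous one, so the two maps are inverse to each other.
-/

noncomputable section

namespace CircInv

open scoped Real

variable {k m n : ℕ} {E F G : Type*} [NormedAddCommGroup E] [NormedSpace ℝ E]
  [NormedAddCommGroup F] [NormedSpace ℝ F] [NormedAddCommGroup G] [NormedSpace ℝ G]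

theorem hasFDerivAt_of_linearIsometry_comp {X Y Z : Type*} [NormedAddCommGroup X] [NormedSpace ℝ X]
    [NormedAddCommGroup Y] [NormedSpace ℝ Y] [NormedAddCommGroup Z] [NormedSpace ℝ Z]
    (J : Y →ₗᵢ[ℝ] Z) {f : X → Y} {f' : X →L[ℝ] Y} {x : X}
    (h : HasFDerivAt (J ∘ f) (J.toContinuousLinearMap.comp f') x) : HasFDerivAt f f' x := by
  refine .of_isLittleO (Asymptotics.IsLittleO.of_norm_left ?_)
  refine h.isLittleO.norm_left.congr_left fun y => ?_
  rw [← J.norm_map, map_sub J, map_sub J]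
  rfl

namespace Ck

theorem ext {f g : Ck n E} (h : ∀ φ : S1, f φ = g φ) : f = g :=
  Subtype.ext (funext h)

theorem ext_coe {f g : Ck n E} (h : ∀ x : ℝ, f (x : S1) = g (x : S1)) : f = g :=
  ext fun φ => QuotientAddGroup.induction_on φ h

/-- The element of `Cⁿ(S¹; E)` given by a function that is of class `Cⁿ` in the angle. -/
def ofContDiff (f : S1 → E) (hf : ContDiff ℝ n fun x : ℝ => f (x : S1)) : Ck n E := ⟨f, hf⟩

theorem sub_apply (f g : Ck n E) (φ : S1) : (f - g) φ = f φ - g φ := rfl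

theorem norm_iteratedDeriv_le (f : Ck n E) {i : ℕ} (hi : i ≤ n) (x : ℝ) :
    ‖iteratedDeriv i (fun y : ℝ => f (y : S1)) x‖ ≤ ‖f‖ := by
  rw [← angDeriv_coe]
  exact (f.norm_le_iff (norm_nonneg f)).mp le_rfl i hi x

theorem norm_le_of_iteratedDeriv (f : Ck n E) {C : ℝ} (hC : 0 ≤ C)
    (h : ∀ i ≤ n, ∀ x : ℝ, ‖iteratedDeriv i (fun y : ℝ => f (y : S1)) x‖ ≤ C) : ‖f‖ ≤ C := by
  refine (f.norm_le_iff hC).mpr fun i hi φ => ?_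
  induction φ using QuotientAddGroup.induction_on with
  | H x => exact (angDeriv_coe i f x).symm ▸ h i hi x

theorem norm_apply_le (f : Ck n E) (φ : S1) : ‖f φ‖ ≤ ‖f‖ := by
  induction φ using QuotientAddGroup.induction_on with
  | H x => simpa only [iteratedDeriv_zero] using f.norm_iteratedDeriv_le (Nat.zero_le n) x

theorem norm_le_of_forall_norm_apply_le (f : Ck 0 E) {C : ℝ} (hC : 0 ≤ C)
    (h : ∀ φ : S1, ‖f φ‖ ≤ C) : ‖f‖ ≤ C := by
  refine f.norm_le_of_iteratedDeriv hC fun i hi x => ?_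
  obtain rfl : i = 0 := Nat.le_zero.mp hi
  simpa only [iteratedDeriv_zero] using h x

theorem continuous (f : Ck n E) : Continuous f :=
  continuous_coinduced_dom.mpr f.contDiff.continuous

theorem continuous_eval : Continuous fun q : Ck n E × S1 => q.1 q.2 :=
  continuous_prod_of_continuous_lipschitzWith _ 1 continuous fun φ =>
    LipschitzWith.of_dist_le_mul fun f g => by
      simpa only [NNReal.coe_one, one_mul, dist_eq_norm, sub_apply] using (f - g).norm_apply_le φ

/-- The inclusion `Cⁿ(S¹; E) ⊆ Cᵐ(S¹; E)` for `m ≤ n`. -/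
def incl (h : m ≤ n) : Ck n E →L[ℝ] Ck m E :=
  LinearMap.mkContinuous
    ⟨⟨fun f => ofContDiff f (f.contDiff.of_le (by exact_mod_cast h)), fun _ _ => rfl⟩,
      fun _ _ => rfl⟩ 1
    fun f => norm_le_of_iteratedDeriv _ (by positivity) fun _ hi x =>
      (f.norm_iteratedDeriv_le (hi.trans h) x).trans_eq (one_mul _).symm

/-- The function constantly equal to `c`, as an element of `Cⁿ(S¹; E)`. -/
def const (c : E) : Ck n E := ofContDiff (fun _ => c) contDiff_const

theorem angDeriv_one_comp_coe (f : S1 → E) :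
    (fun x : ℝ => angDeriv 1 f (x : S1)) = deriv fun x : ℝ => f (x : S1) := by
  funext x
  rw [angDeriv_coe, iteratedDeriv_one]

theorem contDiff_angDeriv_one (f : Ck (n + 1) E) :
    ContDiff ℝ n fun x : ℝ => angDeriv 1 f (x : S1) := by
  rw [angDeriv_one_comp_coe]
  exact (contDiff_succ_iff_deriv.mp (by exact_mod_cast f.contDiff)).2.2

theorem hasDerivAt_coe (f : Ck (n + 1) E) (x : ℝ) :
    HasDerivAt (fun y : ℝ => f (y : S1)) (angDeriv 1 f (x : S1)) x := by
  rw [congrFun (angDeriv_one_comp_coe f) x]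
  exact (f.contDiff.differentiable (by simp) x).hasDerivAt

theorem iteratedDeriv_angDeriv_one (f : S1 → E) (i : ℕ) :
    iteratedDeriv i (fun x : ℝ => angDeriv 1 f (x : S1)) =
      iteratedDeriv (i + 1) fun x : ℝ => f (x : S1) := by
  rw [angDeriv_one_comp_coe, ← iteratedDeriv_succ']

/-- Differentiation with respect to the angle, as a map `Cⁿ⁺¹(S¹; E) → Cⁿ(S¹; E)`. -/
def D : Ck (n + 1) E →L[ℝ] Ck n E :=
  LinearMap.mkContinuous
    ⟨⟨fun f => ofContDiff (angDeriv 1 f) f.contDiff_angDeriv_one,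
      fun f g => ext_coe fun x => ((f + g).hasDerivAt_coe x).unique
        ((f.hasDerivAt_coe x).add (g.hasDerivAt_coe x))⟩,
      fun c f => ext_coe fun x => ((c • f).hasDerivAt_coe x).unique
        ((f.hasDerivAt_coe x).const_smul c)⟩ 1
    fun f => norm_le_of_iteratedDeriv _ (by positivity) fun i hi x => by
      rw [one_mul]
      exact (congrFun (iteratedDeriv_angDeriv_one f i) x).symm ▸
        f.norm_iteratedDeriv_le (Nat.succ_le_succ hi) x

theorem norm_D_le (f : Ck (n + 1) E) : ‖D f‖ ≤ ‖f‖ := by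
  simpa only [one_mul] using D.le_of_opNorm_le (LinearMap.mkContinuous_norm_le _ zero_le_one _) f

theorem hasDerivAt_add_coe (f : Ck (n + 1) E) (φ : S1) (t : ℝ) :
    HasDerivAt (fun s : ℝ => f (φ + (s : S1))) (D f (φ + (t : S1))) t := by
  induction φ using QuotientAddGroup.induction_on with
  | H x => exact (f.hasDerivAt_coe (x + t)).comp_const_add x t

theorem D_eq_of_hasDerivAt {f : Ck (n + 1) E} {f' : Ck n E}
    (h : ∀ x : ℝ, HasDerivAt (fun y : ℝ => f (y : S1)) (f' (x : S1)) x) : D f = f' :=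
  ext_coe fun x => (f.hasDerivAt_coe x).unique (h x)

/-- The embedding `f ↦ (f, f')` of `Cⁿ⁺¹(S¹; E)` into `C⁰(S¹; E) × Cⁿ(S¹; E)`, which is isometric
for the maximum norms. It reduces statements about `Cⁿ(S¹; E)` to induction on `n`. -/
def splitDeriv : Ck (n + 1) E →ₗᵢ[ℝ] Ck 0 E × Ck n E where
  toLinearMap := (incl (Nat.zero_le _)).toLinearMap.prod D.toLinearMap
  norm_map' f := by
    change max ‖incl (Nat.zero_le _) f‖ ‖D f‖ = ‖f‖
    apply le_antisymm
    · exact max_le (norm_le_of_forall_norm_apply_le _ (norm_nonneg f) f.norm_apply_le) f.norm_D_le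
    · refine f.norm_le_of_iteratedDeriv (le_max_of_le_left (norm_nonneg _)) fun i hi x => ?_
      cases i with
      | zero =>
        exact le_max_of_le_left ((incl (Nat.zero_le _) f).norm_iteratedDeriv_le le_rfl x)
      | succ i =>
        rw [← iteratedDeriv_angDeriv_one]
        exact le_max_of_le_right ((D f).norm_iteratedDeriv_le (Nat.le_of_succ_le_succ hi) x)

section Operators

variable {W : Type*} [NormedAddCommGroup W] [NormedSpace ℝ W]

theorem continuous_of_incl_comp_of_D_comp {X : Type*} [TopologicalSpace X]
    {f : X → W →L[ℝ] Ck (n + 1) E} (h_incl : Continuous fun x => (incl (Nat.zero_le _)).comp (f x))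
    (h_D : Continuous fun x => D.comp (f x)) : Continuous f := by
  refine splitDeriv.postcomp.isometry.isEmbedding.continuous_iff.mpr ?_
  exact (ContinuousLinearMap.prodₗᵢ ℝ).continuous.comp (h_incl.prodMk h_D)

theorem hasFDerivAt_of_incl_comp_of_D_comp {X : Type*} [NormedAddCommGroup X] [NormedSpace ℝ X]
    {f : X → W →L[ℝ] Ck (n + 1) E} {f' : X →L[ℝ] W →L[ℝ] Ck (n + 1) E} {x : X}
    (h_incl : HasFDerivAt (fun y => (incl (Nat.zero_le _)).comp (f y))
      ((ContinuousLinearMap.postcomp W (incl (Nat.zero_le _))).comp f') x)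
    (h_D : HasFDerivAt (fun y => D.comp (f y))
      ((ContinuousLinearMap.postcomp W D).comp f') x) : HasFDerivAt f f' x := by
  refine hasFDerivAt_of_linearIsometry_comp
    (splitDeriv.postcomp : (W →L[ℝ] Ck (n + 1) E) →ₗᵢ[ℝ] W →L[ℝ] Ck 0 E × Ck n E) ?_
  exact (ContinuousLinearMap.prodₗᵢ ℝ).toContinuousLinearEquiv.hasFDerivAt.comp x
    (h_incl.prodMk h_D)

end Operators

section Bilinear

theorem contDiff_bilin (B : E →L[ℝ] F →L[ℝ] G) (f : Ck n E) (g : Ck n F) :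
    ContDiff ℝ n fun x : ℝ => B (f (x : S1)) (g (x : S1)) :=
  (B.contDiff.comp f.contDiff).clm_apply g.contDiff

theorem norm_iteratedDeriv_bilin_le (B : E →L[ℝ] F →L[ℝ] G) (f : Ck n E) (g : Ck n F) {i : ℕ}
    (hi : i ≤ n) (x : ℝ) :
    ‖iteratedDeriv i (fun y : ℝ => B (f (y : S1)) (g (y : S1))) x‖ ≤
      ‖B‖ * 2 ^ n * ‖f‖ * ‖g‖ := by
  rw [← norm_iteratedFDeriv_eq_norm_iteratedDeriv]
  calc
    _ ≤ ‖B‖ * ∑ j ∈ Finset.range (i + 1), (i.choose j : ℝ) *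
          ‖iteratedFDeriv ℝ j (fun y : ℝ => f (y : S1)) x‖ *
          ‖iteratedFDeriv ℝ (i - j) (fun y : ℝ => g (y : S1)) x‖ :=
      B.norm_iteratedFDeriv_le_of_bilinear f.contDiff g.contDiff x (by exact_mod_cast hi)
    _ ≤ ‖B‖ * ∑ j ∈ Finset.range (i + 1), (i.choose j : ℝ) * ‖f‖ * ‖g‖ := by
      simp only [norm_iteratedFDeriv_eq_norm_iteratedDeriv]
      gcongr with j hj
      · exact f.norm_iteratedDeriv_le ((Finset.mem_range_succ_iff.mp hj).trans hi) x
      · exact g.norm_iteratedDeriv_le ((Nat.sub_le i j).trans hi) x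
    _ = ‖B‖ * 2 ^ i * ‖f‖ * ‖g‖ := by
      rw [← Finset.sum_mul, ← Finset.sum_mul, ← Nat.cast_sum, Nat.sum_range_choose]
      push_cast
      ring
    _ ≤ ‖B‖ * 2 ^ n * ‖f‖ * ‖g‖ := by
      gcongr
      norm_num

/-- The pointwise application `(f, g) ↦ B (f ·) (g ·)` of a continuous bilinear map `B`. -/
def bilin (B : E →L[ℝ] F →L[ℝ] G) : Ck n E →L[ℝ] Ck n F →L[ℝ] Ck n G :=
  LinearMap.mkContinuous₂
    (LinearMap.mk₂ ℝ
      (fun f g => ofContDiff (fun φ => B (f φ) (g φ)) (contDiff_bilin B f g))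
      (fun f f' g => ext fun φ => B.map_add₂ (f φ) (f' φ) (g φ))
      (fun c f g => ext fun φ => B.map_smul₂ c (f φ) (g φ))
      (fun f g g' => ext fun φ => (B (f φ)).map_add (g φ) (g' φ))
      (fun c f g => ext fun φ => (B (f φ)).map_smul c (g φ)))
    (‖B‖ * 2 ^ n) fun f g => norm_le_of_iteratedDeriv _ (by positivity) fun _ hi x =>
      norm_iteratedDeriv_bilin_le B f g hi x

/-- Pointwise multiplication `(g, f) ↦ g f` of a vector-valued function by a scalar function. -/
def mul : Ck n ℝ →L[ℝ] Ck n E →L[ℝ] Ck n E := bilin (ContinuousLinearMap.lsmul ℝ ℝ)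

theorem D_mul (g : Ck (n + 1) ℝ) (f : Ck (n + 1) E) :
    D (mul g f) = mul (incl n.le_succ g) (D f) + mul (D g) (incl n.le_succ f) :=
  D_eq_of_hasDerivAt fun x => (g.hasDerivAt_coe x).fun_smul (f.hasDerivAt_coe x)

theorem isInvertible_mul {g : Ck n ℝ} (hg : ∀ φ : S1, g φ ≠ 0) :
    (mul g : Ck n E →L[ℝ] Ck n E).IsInvertible := by
  let ginv : Ck n ℝ := ofContDiff (fun φ => (g φ)⁻¹) (g.contDiff.inv fun x => hg x)
  refine .of_inverse (g := mul ginv) ?_ ?_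
  · exact ContinuousLinearMap.ext fun f => ext fun φ => smul_inv_smul₀ (hg φ) (f φ)
  · exact ContinuousLinearMap.ext fun f => ext fun φ => inv_smul_smul₀ (hg φ) (f φ)

end Bilinear

section Complete

/-- `C⁰(S¹; E)` is the space of continuous maps with the supremum norm. -/
def equivContinuousMap : Ck 0 E ≃ₗᵢ[ℝ] C(S1, E) where
  toFun f := ⟨f, f.continuous⟩
  map_add' _ _ := rfl
  map_smul' _ _ := rfl
  invFun f := ofContDiff f (contDiff_zero.mpr (f.continuous.comp (AddCircle.continuous_mk' _)))
  left_inv _ := rfl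
  right_inv _ := rfl
  norm_map' f := by
    let f_toContinuousMap : C(S1, E) := ⟨f, f.continuous⟩
    refine le_antisymm ?_ ?_
    · exact (ContinuousMap.norm_le _ (norm_nonneg f)).mpr f.norm_apply_le
    · exact f.norm_le_of_forall_norm_apply_le (norm_nonneg _) f_toContinuousMap.norm_coe_le_norm

theorem tendstoUniformly_of_tendsto {ι : Type*} {l : Filter ι} {u : ι → Ck n E} {f : Ck n E}
    (h : Tendsto u l (𝓝 f)) :
    TendstoUniformly (fun i (x : ℝ) => u i (x : S1)) (fun x : ℝ => f (x : S1)) l := by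
  rw [Metric.tendstoUniformly_iff]
  intro ε hε
  filter_upwards [Metric.tendsto_nhds.mp h ε hε] with i hi x
  rw [dist_comm, dist_eq_norm]
  exact ((u i - f).norm_apply_le x).trans_lt (dist_eq_norm (u i) f ▸ hi)

theorem range_splitDeriv :
    range (splitDeriv : Ck (n + 1) E →ₗᵢ[ℝ] Ck 0 E × Ck n E) =
      {q | ∀ x : ℝ, HasDerivAt (fun y : ℝ => q.1 (y : S1)) (q.2 (x : S1)) x} := by
  refine Subset.antisymm (range_subset_iff.mpr hasDerivAt_coe) fun ⟨f, f'⟩ hf => ?_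
  have hderiv : deriv (fun y : ℝ => f (y : S1)) = fun x : ℝ => f' (x : S1) :=
    funext fun x => (hf x).deriv
  have hf_contDiff : ContDiff ℝ (n + 1 : ℕ) fun y : ℝ => f (y : S1) := by
    push_cast
    exact contDiff_succ_iff_deriv.mpr
      ⟨fun x => (hf x).differentiableAt, by simp, hderiv ▸ f'.contDiff⟩
  exact ⟨ofContDiff f hf_contDiff, Prod.ext rfl (D_eq_of_hasDerivAt hf)⟩

theorem isClosed_range_splitDeriv :
    IsClosed (range (splitDeriv : Ck (n + 1) E →ₗᵢ[ℝ] Ck 0 E × Ck n E)) := by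
  rw [range_splitDeriv]
  refine IsSeqClosed.isClosed fun u q hu hq x => ?_
  have hq_fst := tendstoUniformly_of_tendsto ((Prod.tendsto_iff _ _).mp hq).1
  have hq_snd := tendstoUniformly_of_tendsto ((Prod.tendsto_iff _ _).mp hq).2
  exact hasDerivAt_of_tendstoUniformly hq_snd (Eventually.of_forall fun j => hu j)
    hq_fst.tendsto_at x

instance completeSpace [CompleteSpace E] : CompleteSpace (Ck n E) := by
  have completeSpace_zero : CompleteSpace (Ck 0 E) :=
    equivContinuousMap.toIsometryEquiv.completeSpace
  induction n with
  | zero => exact completeSpace_zero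
  | succ n ih =>
    exact (completeSpace_iff_isComplete_range splitDeriv.isometry.isUniformInducing).mpr
      isClosed_range_splitDeriv.isComplete

end Complete

end Ck

/-- The map `φ ↦ φ + τ φ mod 2π` of the circle whose displacement is the real function `τ`. -/
def displace (τ : S1 → ℝ) (φ : S1) : S1 := φ + (τ φ : S1)

section Pullback

theorem contDiff_add_coe (τ : Ck k ℝ) : ContDiff ℝ k fun x : ℝ => x + τ (x : S1) :=
  contDiff_id.add τ.contDiff

theorem norm_iteratedDeriv_add_coe_le (τ : Ck k ℝ) {i : ℕ} (hi₁ : 1 ≤ i) (hi : i ≤ k) (x : ℝ) :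
    ‖iteratedDeriv i (fun y : ℝ => y + τ (y : S1)) x‖ ≤ (1 + ‖τ‖) ^ i := by
  have norm_iteratedDeriv_id_le : ‖iteratedDeriv i (fun y : ℝ => y) x‖ ≤ 1 := by
    obtain ⟨j, rfl⟩ := Nat.exists_eq_succ_of_ne_zero (Nat.one_le_iff_ne_zero.mp hi₁)
    rw [iteratedDeriv_succ', deriv_id'', iteratedDeriv_const]
    split_ifs <;> simp
  rw [iteratedDeriv_fun_add contDiffAt_fun_id
    (τ.contDiff.of_le (by exact_mod_cast hi)).contDiffAt]
  calc
    _ ≤ 1 + ‖τ‖ := norm_add_le_of_le norm_iteratedDeriv_id_le (τ.norm_iteratedDeriv_le hi x)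
    _ ≤ (1 + ‖τ‖) ^ i :=
      le_self_pow₀ (le_add_of_nonneg_right (norm_nonneg τ)) (Nat.one_le_iff_ne_zero.mp hi₁)

theorem norm_iteratedDeriv_comp_displace_le (h : k ≤ n) (τ : Ck k ℝ) (σ : Ck n E) {i : ℕ}
    (hi : i ≤ k) (x : ℝ) :
    ‖iteratedDeriv i (fun y : ℝ => σ (displace τ (y : S1))) x‖ ≤
      k.factorial * (1 + ‖τ‖) ^ k * ‖σ‖ := by
  rw [← norm_iteratedFDeriv_eq_norm_iteratedDeriv]
  calc
    _ ≤ i.factorial * ‖σ‖ * (1 + ‖τ‖) ^ i := by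
      refine norm_iteratedFDeriv_comp_le (N := k) (g := fun y : ℝ => σ (y : S1))
        (σ.contDiff.of_le (by exact_mod_cast h)) (contDiff_add_coe τ) (by exact_mod_cast hi) x
        (fun j hj => ?_) fun j hj₁ hj => ?_
      all_goals rw [norm_iteratedFDeriv_eq_norm_iteratedDeriv]
      · exact σ.norm_iteratedDeriv_le (hj.trans (hi.trans h)) _
      · exact norm_iteratedDeriv_add_coe_le τ hj₁ (hj.trans hi) x
    _ ≤ k.factorial * ‖σ‖ * (1 + ‖τ‖) ^ k := by
      gcongr
      exact le_add_of_nonneg_right (norm_nonneg τ)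
    _ = _ := by ring

/-- The composition operator `σ ↦ σ ∘ (id + τ)` from `Cⁿ(S¹; E)` to `Cᵏ(S¹; E)`, for a
displacement `τ` of class `Cᵏ` and `k ≤ n`. -/
def pullback (h : k ≤ n) (τ : Ck k ℝ) : Ck n E →L[ℝ] Ck k E :=
  LinearMap.mkContinuous
    ⟨⟨fun σ => Ck.ofContDiff (fun φ => σ (displace τ φ))
        ((σ.contDiff.of_le (by exact_mod_cast h)).comp (contDiff_add_coe τ)),
      fun _ _ => rfl⟩, fun _ _ => rfl⟩ (k.factorial * (1 + ‖τ‖) ^ k)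
    fun σ => Ck.norm_le_of_iteratedDeriv _ (by positivity) fun _ hi x =>
      norm_iteratedDeriv_comp_displace_le h τ σ hi x

theorem D_pullback (h : k ≤ n) (τ : Ck (k + 1) ℝ) (σ : Ck (n + 1) E) :
    Ck.D (pullback (Nat.succ_le_succ h) τ σ) =
      Ck.mul (Ck.const 1 + Ck.D τ) (pullback h (Ck.incl k.le_succ τ) (Ck.D σ)) :=
  Ck.D_eq_of_hasDerivAt fun x => HasDerivAt.scomp (g₁ := fun y : ℝ => σ (y : S1)) x
    (σ.hasDerivAt_coe (x + τ x)) ((hasDerivAt_id' x).fun_add (τ.hasDerivAt_coe x))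

theorem D_comp_pullback (h : k ≤ n) (τ : Ck (k + 1) ℝ) :
    Ck.D.comp (pullback (Nat.succ_le_succ h) τ : Ck (n + 1) E →L[ℝ] Ck (k + 1) E) =
      (Ck.mul (Ck.const 1 + Ck.D τ)).comp ((pullback h (Ck.incl k.le_succ τ)).comp Ck.D) :=
  ContinuousLinearMap.ext (D_pullback h τ)

theorem norm_add_coe_sub_le (σ : Ck (n + 1) E) (φ : S1) (t : ℝ) :
    ‖σ (φ + (t : S1)) - σ φ‖ ≤ ‖σ‖ * |t| := by
  have mean_value := convex_univ.norm_image_sub_le_of_norm_hasDerivWithin_le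
    (fun s _ => (σ.hasDerivAt_add_coe φ s).hasDerivWithinAt)
    (fun s _ => ((Ck.D σ).norm_apply_le _).trans σ.norm_D_le) (mem_univ 0) (mem_univ t)
  simpa only [AddCircle.coe_zero, add_zero, sub_zero, Real.norm_eq_abs] using mean_value

theorem norm_add_coe_sub_sub_smul_le (σ : Ck (n + 2) E) (φ : S1) (t : ℝ) :
    ‖σ (φ + (t : S1)) - σ φ - t • Ck.D σ φ‖ ≤ ‖σ‖ * |t| * |t| := by
  have remainder_hasDerivAt (s : ℝ) :
      HasDerivAt (fun s : ℝ => σ (φ + (s : S1)) - s • Ck.D σ φ)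
        (Ck.D σ (φ + (s : S1)) - Ck.D σ φ) s := by
    simpa only [one_smul] using
      (σ.hasDerivAt_add_coe φ s).fun_sub ((hasDerivAt_id' s).smul_const (Ck.D σ φ))
  have norm_deriv_le (s : ℝ) (hs : s ∈ uIcc 0 t) :
      ‖Ck.D σ (φ + (s : S1)) - Ck.D σ φ‖ ≤ ‖σ‖ * |t| := by
    have : |s| ≤ |t| := by simpa only [sub_zero] using abs_sub_left_of_mem_uIcc hs
    refine (norm_add_coe_sub_le (Ck.D σ) φ s).trans ?_
    gcongr
    exact σ.norm_D_le
  have mean_value := (convex_uIcc 0 t).norm_image_sub_le_of_norm_hasDerivWithin_le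
    (fun s _ => (remainder_hasDerivAt s).hasDerivWithinAt) norm_deriv_le left_mem_uIcc
    right_mem_uIcc
  simpa only [AddCircle.coe_zero, add_zero, zero_smul, sub_zero, Real.norm_eq_abs,
    sub_right_comm] using mean_value

theorem displace_eq_displace_add (τ τ' : S1 → ℝ) (φ : S1) :
    displace τ' φ = displace τ φ + ((τ' φ - τ φ : ℝ) : S1) := by
  rw [displace, displace, add_assoc, ← AddCircle.coe_add, add_sub_cancel]

theorem lipschitzWith_pullback_zero :
    LipschitzWith 1 (pullback (Nat.zero_le (n + 1)) : Ck 0 ℝ → Ck (n + 1) E →L[ℝ] Ck 0 E) := by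
  refine LipschitzWith.of_dist_le_mul fun τ' τ => ?_
  rw [NNReal.coe_one, one_mul, dist_eq_norm, dist_eq_norm]
  refine ContinuousLinearMap.opNorm_le_bound _ (norm_nonneg _) fun σ => ?_
  refine Ck.norm_le_of_forall_norm_apply_le _ (by positivity) fun φ => ?_
  change ‖σ (displace τ' φ) - σ (displace τ φ)‖ ≤ _
  rw [displace_eq_displace_add τ τ']
  calc
    _ ≤ ‖σ‖ * |τ' φ - τ φ| := norm_add_coe_sub_le σ _ _
    _ ≤ ‖σ‖ * ‖τ' - τ‖ := by
      gcongr
      exact (τ' - τ).norm_apply_le φ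
    _ = _ := mul_comm _ _

theorem continuous_pullback (hkn : k ≤ n) (h : k + 1 ≤ n) :
    Continuous (pullback hkn : Ck k ℝ → Ck n E →L[ℝ] Ck k E) := by
  induction k generalizing n with
  | zero =>
    obtain ⟨n, rfl⟩ := Nat.exists_eq_add_of_le' h
    exact lipschitzWith_pullback_zero.continuous
  | succ k ih =>
    obtain ⟨n, rfl⟩ := Nat.exists_eq_succ_of_ne_zero (Nat.ne_zero_of_lt hkn)
    have hkn' : k ≤ n := Nat.le_of_succ_le_succ hkn
    refine Ck.continuous_of_incl_comp_of_D_comp ?_ ?_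
    · exact lipschitzWith_pullback_zero.continuous.comp (Ck.incl (Nat.zero_le _)).continuous
    · simp only [D_comp_pullback hkn']
      have continuous_pullback_incl := (ih hkn' (Nat.le_of_succ_le_succ h)).comp
        (Ck.incl k.le_succ).continuous
      have continuous_mul := (Ck.mul (n := k) (E := E)).continuous.comp
        (Ck.D.continuous.const_add (Ck.const 1))
      exact continuous_mul.clm_comp (continuous_pullback_incl.clm_comp continuous_const)

/-- The operation `T ↦ (η ↦ (σ ↦ η · T σ'))`. Applied to the composition operator `T` on `Cⁿ` it
gives the derivative of the composition operator on `Cⁿ⁺¹` with respect to the displacement. -/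
def pullbackDeriv : (Ck n E →L[ℝ] Ck k E) →L[ℝ] Ck k ℝ →L[ℝ] Ck (n + 1) E →L[ℝ] Ck k E :=
  (ContinuousLinearMap.precomp _ Ck.mul).comp
    ((ContinuousLinearMap.compL ℝ (Ck (n + 1) E) (Ck k E) (Ck k E)).flip.comp
      (ContinuousLinearMap.precomp _ Ck.D))

theorem pullbackDeriv_apply (T : Ck n E →L[ℝ] Ck k E) (η : Ck k ℝ) (σ : Ck (n + 1) E) :
    pullbackDeriv T η σ = Ck.mul η (T (Ck.D σ)) := rfl

theorem hasFDerivAt_pullback_zero (τ : Ck 0 ℝ) :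
    HasFDerivAt (pullback (Nat.zero_le (n + 2)) : Ck 0 ℝ → Ck (n + 2) E →L[ℝ] Ck 0 E)
      (pullbackDeriv (pullback (Nat.zero_le (n + 1)) τ)) τ := by
  have norm_remainder_le (τ' : Ck 0 ℝ) :
      ‖(pullback (Nat.zero_le (n + 2)) τ' : Ck (n + 2) E →L[ℝ] Ck 0 E) -
        pullback (Nat.zero_le (n + 2)) τ -
        pullbackDeriv (pullback (Nat.zero_le (n + 1)) τ) (τ' - τ)‖ ≤ ‖τ' - τ‖ ^ 2 := by
    refine ContinuousLinearMap.opNorm_le_bound _ (by positivity) fun σ => ?_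
    refine Ck.norm_le_of_forall_norm_apply_le _ (by positivity) fun φ => ?_
    change ‖σ (displace τ' φ) - σ (displace τ φ) - (τ' φ - τ φ) • Ck.D σ (displace τ φ)‖ ≤ _
    rw [displace_eq_displace_add τ τ']
    have abs_sub_le : |τ' φ - τ φ| ≤ ‖τ' - τ‖ := (τ' - τ).norm_apply_le φ
    calc
      _ ≤ ‖σ‖ * |τ' φ - τ φ| * |τ' φ - τ φ| := norm_add_coe_sub_sub_smul_le σ _ _
      _ ≤ ‖σ‖ * ‖τ' - τ‖ * ‖τ' - τ‖ := by gcongr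
      _ = _ := by ring
  refine .of_isLittleO ((Asymptotics.IsBigO.of_norm_le norm_remainder_le).trans_isLittleO ?_)
  exact Asymptotics.isLittleO_pow_sub_sub τ one_lt_two

theorem hasFDerivAt_pullback (hkn : k ≤ n) (h : k + 1 ≤ n) (τ : Ck k ℝ) :
    HasFDerivAt (pullback (Nat.le_succ_of_le hkn) : Ck k ℝ → Ck (n + 1) E →L[ℝ] Ck k E)
      (pullbackDeriv (pullback hkn τ)) τ := by
  induction k generalizing n with
  | zero =>
    obtain ⟨n, rfl⟩ := Nat.exists_eq_add_of_le' h
    exact hasFDerivAt_pullback_zero τ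
  | succ k ih =>
    obtain ⟨n, rfl⟩ := Nat.exists_eq_add_of_le' (le_of_add_le_right h)
    have hkn' : k ≤ n := Nat.le_of_succ_le_succ hkn
    refine Ck.hasFDerivAt_of_incl_comp_of_D_comp ?_ ?_
    · exact (hasFDerivAt_pullback_zero _).comp τ (Ck.incl (Nat.zero_le _)).hasFDerivAt
    · simp only [D_comp_pullback (Nat.le_succ_of_le hkn')]
      have hasFDerivAt_pullback_D :=
        (ContinuousLinearMap.precomp (Ck k E) (Ck.D (n := n + 1) (E := E))).hasFDerivAt.comp τ
          ((ih hkn' (Nat.le_of_succ_le_succ h) (Ck.incl k.le_succ τ)).comp τ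
            (Ck.incl k.le_succ).hasFDerivAt)
      have hasFDerivAt_mul := (Ck.mul (n := k) (E := E)).hasFDerivAt.comp τ
        (Ck.D.hasFDerivAt.const_add (Ck.const 1))
      refine (hasFDerivAt_mul.clm_comp hasFDerivAt_pullback_D).congr_fderiv ?_
      refine ContinuousLinearMap.ext fun η => ContinuousLinearMap.ext fun σ => ?_
      have D_pullbackDeriv_apply : Ck.D (pullbackDeriv (pullback hkn τ) η σ) =
          Ck.mul (Ck.const 1 + Ck.D τ)
              (Ck.mul (Ck.incl k.le_succ η)
                (pullback hkn' (Ck.incl k.le_succ τ) (Ck.D (Ck.D σ)))) +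
            Ck.mul (Ck.D η)
              (pullback (Nat.le_succ_of_le hkn') (Ck.incl k.le_succ τ) (Ck.D σ)) := by
        rw [pullbackDeriv_apply, Ck.D_mul, D_pullback hkn']
        exact congrArg (· + _) (Ck.ext fun φ => smul_comm _ _ _)
      exact D_pullbackDeriv_apply.symm

theorem contDiff_pullback (ℓ : ℕ) (hkn : k ≤ n) (h : k + ℓ + 1 ≤ n) :
    ContDiff ℝ ℓ (pullback hkn : Ck k ℝ → Ck n E →L[ℝ] Ck k E) := by
  induction ℓ generalizing n with
  | zero => exact contDiff_zero.mpr (continuous_pullback hkn h)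
  | succ ℓ ih =>
    obtain ⟨n, rfl⟩ := Nat.exists_eq_add_of_le' (le_of_add_le_right h)
    have hkn' : k ≤ n := by omega
    rw [Nat.cast_succ, contDiff_succ_iff_hasFDerivAt]
    exact ⟨_, pullbackDeriv.contDiff.comp (ih hkn' (by omega)),
      hasFDerivAt_pullback hkn' (by omega)⟩

end Pullback

section Chord

variable {H : Type*} [NormedAddCommGroup H] [InnerProductSpace ℝ H]

/-- The radial speed `⟨γ'(ψ), γ(ψ) - γ(φ)⟩` of the curve `γ` at the parameter `ψ` relative to the
point `γ φ`. It is half the derivative of `|γ(ψ) - γ(φ)|²` with respect to `ψ`, and it is nonzero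
exactly where `γ` crosses a circle about `γ φ` transversally. -/
def radialSpeed (γ : S1 → H) (φ ψ : S1) : ℝ := inner ℝ (angDeriv 1 γ ψ) (γ ψ - γ φ)

/-- The chord function `φ ↦ γ(φ + τ φ) - γ(φ)` of a curve `γ` and a displacement `τ`. -/
def chord (h : k ≤ n) (q : Ck n H × Ck k ℝ) : Ck k H := pullback h q.2 q.1 - Ck.incl h q.1

theorem contDiff_chord (ℓ : ℕ) (hkn : k ≤ n) (h : k + ℓ + 1 ≤ n) :
    ContDiff ℝ ℓ (chord hkn : Ck n H × Ck k ℝ → Ck k H) :=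
  (((contDiff_pullback ℓ hkn h).comp contDiff_snd).clm_apply contDiff_fst).sub
    ((Ck.incl hkn).contDiff.comp contDiff_fst)

theorem hasFDerivAt_chord (hkn : k ≤ n) (h : k + 1 ≤ n) (q : Ck (n + 1) H × Ck k ℝ) :
    HasFDerivAt (chord (Nat.le_succ_of_le hkn))
      ((pullback (Nat.le_succ_of_le hkn) q.2).comp (.fst ℝ _ _) +
        (Ck.mul.flip (pullback hkn q.2 (Ck.D q.1))).comp (.snd ℝ _ _) -
        (Ck.incl (Nat.le_succ_of_le hkn)).comp (.fst ℝ _ _)) q :=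
  (((hasFDerivAt_pullback hkn h q.2).comp q hasFDerivAt_snd).clm_apply hasFDerivAt_fst).sub
    ((Ck.incl _).hasFDerivAt.comp q hasFDerivAt_fst)

/-- The squared chord length `φ ↦ |γ(φ + τ φ) - γ(φ)|²`. -/
def chordSq (h : k ≤ n) (q : Ck n H × Ck k ℝ) : Ck k ℝ :=
  Ck.bilin (innerSL ℝ) (chord h q) (chord h q)

theorem chordSq_apply (h : k ≤ n) (q : Ck n H × Ck k ℝ) (φ : S1) :
    chordSq h q φ = dist (q.1 (displace q.2 φ)) (q.1 φ) ^ 2 := by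
  rw [dist_eq_norm]
  exact real_inner_self_eq_norm_sq (chord h q φ)

theorem contDiff_chordSq (ℓ : ℕ) (hkn : k ≤ n) (h : k + ℓ + 1 ≤ n) :
    ContDiff ℝ ℓ (chordSq hkn : Ck n H × Ck k ℝ → Ck k ℝ) :=
  ((Ck.bilin (innerSL ℝ)).contDiff.comp (contDiff_chord ℓ hkn h)).clm_apply
    (contDiff_chord ℓ hkn h)

theorem fderiv_chordSq_apply (hkn : k ≤ n) (h : k + 1 ≤ n) (q v : Ck (n + 1) H × Ck k ℝ)
    (φ : S1) :
    fderiv ℝ (chordSq (Nat.le_succ_of_le hkn)) q v φ =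
      2 * (inner ℝ (v.1 (displace q.2 φ) - v.1 φ) (q.1 (displace q.2 φ) - q.1 φ) +
        v.2 φ * radialSpeed q.1 φ (displace q.2 φ)) := by
  have h_chord := hasFDerivAt_chord hkn h q
  have h_chordSq : HasFDerivAt (chordSq (Nat.le_succ_of_le hkn)) _ q :=
    (Ck.bilin (innerSL ℝ)).hasFDerivAt_of_bilinear h_chord h_chord
  rw [h_chordSq.fderiv]
  set c := q.1 (displace q.2 φ) - q.1 φ
  set w := v.1 (displace q.2 φ) + v.2 φ • angDeriv 1 q.1 (displace q.2 φ) - v.1 φ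
  have w_eq : w = v.1 (displace q.2 φ) - v.1 φ + v.2 φ • angDeriv 1 q.1 (displace q.2 φ) :=
    add_sub_right_comm _ _ _
  calc
    _ = inner ℝ c w + inner ℝ w c := rfl
    _ = 2 * inner ℝ w c := by rw [real_inner_comm, two_mul]
    _ = _ := by
      rw [w_eq, inner_add_left, real_inner_smul_left, radialSpeed]

theorem isInvertible_fderiv_chordSq_comp_inr (hkn : k ≤ n) (h : k + 1 ≤ n) {γ : Ck (n + 1) H}
    {τ : Ck k ℝ} (hτ : ∀ φ, radialSpeed γ φ (displace τ φ) ≠ 0) :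
    ((fderiv ℝ (chordSq (Nat.le_succ_of_le hkn)) (γ, τ)).comp (.inr ℝ _ _)).IsInvertible := by
  let speed : Ck k ℝ := Ck.bilin (innerSL ℝ) (pullback hkn τ (Ck.D γ))
    (chord (Nat.le_succ_of_le hkn) (γ, τ))
  have partial_deriv_eq : (fderiv ℝ (chordSq (Nat.le_succ_of_le hkn)) (γ, τ)).comp (.inr ℝ _ _) =
      Ck.mul ((2 : ℝ) • speed) := by
    refine ContinuousLinearMap.ext fun η => Ck.ext fun φ => ?_
    refine (fderiv_chordSq_apply hkn h (γ, τ) (0, η) φ).trans ?_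
    change 2 * (inner ℝ ((0 : H) - 0) _ + η φ * speed φ) = 2 * speed φ * η φ
    rw [sub_zero, inner_zero_left]
    ring
  rw [partial_deriv_eq]
  exact Ck.isInvertible_mul fun φ => mul_ne_zero two_ne_zero (hτ φ)

theorem exists_contDiffAt_dist_displace_eq [CompleteSpace H] {ℓ : ℕ} (hℓ : 1 ≤ ℓ)
    (h : k + ℓ ≤ n) {r : ℝ} {γ₀ : Ck (n + 1) H} {τ₀ : Ck k ℝ}
    (hτ₀ : ∀ φ, dist (γ₀ (displace τ₀ φ)) (γ₀ φ) = r)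
    (hspeed : ∀ φ, radialSpeed γ₀ φ (displace τ₀ φ) ≠ 0) :
    ∃ T : Ck (n + 1) H → Ck k ℝ, ContDiffAt ℝ ℓ T γ₀ ∧ T γ₀ = τ₀ ∧
      ∀ᶠ γ in 𝓝 γ₀, ∀ φ, dist (γ (displace (T γ) φ)) (γ φ) = r := by
  have hkn : k ≤ n := le_of_add_le_left h
  have hℓ₀ : (ℓ : WithTop ℕ∞) ≠ 0 := by exact_mod_cast Nat.one_le_iff_ne_zero.mp hℓ
  have h_contDiff : ContDiffAt ℝ ℓ (chordSq (Nat.le_succ_of_le hkn)) (γ₀, τ₀) :=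
    (contDiff_chordSq ℓ _ (Nat.succ_le_succ h)).contDiffAt
  have h_invertible := isInvertible_fderiv_chordSq_comp_inr hkn (by omega) hspeed
  refine ⟨h_contDiff.implicitFunction hℓ₀ h_invertible,
    h_contDiff.contDiffAt_implicitFunction hℓ₀ h_invertible,
    h_contDiff.implicitFunction_apply_self hℓ₀ h_invertible, ?_⟩
  filter_upwards [h_contDiff.eventually_apply_implicitFunction hℓ₀ h_invertible] with γ hγ φ
  have chordSq_eq := congrArg (fun f : Ck k ℝ => f φ) hγ
  simp only [chordSq_apply, hτ₀] at chordSq_eq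
  exact (sq_eq_sq₀ dist_nonneg (hτ₀ φ ▸ dist_nonneg)).mp chordSq_eq

theorem fderiv_apply_of_dist_displace_eq (h : k + 1 ≤ n) {r : ℝ}
    {T : Ck (n + 1) H → Ck k ℝ} {γ : Ck (n + 1) H} (hT : DifferentiableAt ℝ T γ)
    (hdist : ∀ᶠ γ' in 𝓝 γ, ∀ φ, dist (γ' (displace (T γ') φ)) (γ' φ) = r) {φ : S1}
    (hspeed : radialSpeed γ φ (displace (T γ) φ) ≠ 0) (σ : Ck (n + 1) H) :
    fderiv ℝ T γ σ φ =
      inner ℝ (σ φ - σ (displace (T γ) φ)) (γ (displace (T γ) φ) - γ φ) /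
        radialSpeed γ φ (displace (T γ) φ) := by
  have hkn : k ≤ n := Nat.le_of_succ_le h
  have h_chordSq : DifferentiableAt ℝ (chordSq (Nat.le_succ_of_le hkn)) (γ, T γ) :=
    (contDiff_chordSq 1 _ (Nat.succ_le_succ h)).differentiable (by simp) _
  have chordSq_eventuallyEq :
      (fun γ' => chordSq (Nat.le_succ_of_le hkn) (γ', T γ')) =ᶠ[𝓝 γ]
        fun _ => Ck.const (r ^ 2) := by
    filter_upwards [hdist] with γ' hγ'
    exact Ck.ext fun φ => (chordSq_apply _ _ φ).trans (congrArg (· ^ 2) (hγ' φ))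
  have h_comp : HasFDerivAt (fun γ' => chordSq (Nat.le_succ_of_le hkn) (γ', T γ')) _ γ :=
    HasFDerivAt.comp (f := fun γ' => (γ', T γ')) γ h_chordSq.hasFDerivAt
      ((hasFDerivAt_id γ).prodMk hT.hasFDerivAt)
  have h_deriv := h_comp.unique
    ((hasFDerivAt_const _ γ).congr_of_eventuallyEq chordSq_eventuallyEq)
  have deriv_eq_zero : fderiv ℝ (chordSq (Nat.le_succ_of_le hkn)) (γ, T γ)
      (σ, fderiv ℝ T γ σ) φ = 0 :=
    congrArg (fun L : Ck (n + 1) H →L[ℝ] Ck k ℝ => L σ φ) h_deriv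
  rw [fderiv_chordSq_apply hkn h] at deriv_eq_zero
  rw [eq_div_iff hspeed, ← neg_sub (σ (displace (T γ) φ)), inner_neg_left]
  linarith

end Chord

section IntersectionPair

variable {H : Type*} [NormedAddCommGroup H] [InnerProductSpace ℝ H]

/-- The displacements `a` and `b` describe the intersections of the closed curve `γ` with the
circles of radius `r` about its points: apart from `φ + a φ`, which lies less than half a turn
ahead of `φ`, and `φ + b φ`, which lies less than half a turn behind `φ`, no parameter of `γ` has
distance `r` from `γ φ`. The two points are distinct, and both crossings are transversal. -/
structure IsIntersectionPair (γ : S1 → H) (r : ℝ) (a b : S1 → ℝ) : Prop where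
  a_mem : ∀ φ, a φ ∈ Ioo 0 π
  b_mem : ∀ φ, b φ ∈ Ioo (-π) 0
  dist_eq_iff : ∀ φ, ∀ t ∈ Icc (-π) π, dist (γ (φ + (t : S1))) (γ φ) = r ↔ t = a φ ∨ t = b φ
  ne : ∀ φ, γ (displace a φ) ≠ γ (displace b φ)
  radialSpeed_a_ne : ∀ φ, radialSpeed γ φ (displace a φ) ≠ 0
  radialSpeed_b_ne : ∀ φ, radialSpeed γ φ (displace b φ) ≠ 0

namespace IsIntersectionPair

variable {γ : S1 → H} {r : ℝ} {a b : S1 → ℝ}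

theorem dist_a (h : IsIntersectionPair γ r a b) (φ : S1) : dist (γ (displace a φ)) (γ φ) = r :=
  (h.dist_eq_iff φ (a φ) ⟨(neg_lt_zero.mpr Real.pi_pos).le.trans (h.a_mem φ).1.le,
    (h.a_mem φ).2.le⟩).mpr (Or.inl rfl)

theorem dist_b (h : IsIntersectionPair γ r a b) (φ : S1) : dist (γ (displace b φ)) (γ φ) = r :=
  (h.dist_eq_iff φ (b φ) ⟨(h.b_mem φ).1.le, (h.b_mem φ).2.le.trans Real.pi_pos.le⟩).mpr
    (Or.inr rfl)

theorem setOf_dist_eq (h : IsIntersectionPair γ r a b) (φ : S1) :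
    {ψ | dist (γ ψ) (γ φ) = r} = {displace a φ, displace b φ} := by
  refine Subset.antisymm (fun ψ hψ => ?_) (pair_subset (h.dist_a φ) (h.dist_b φ))
  obtain ⟨t, ht, ht_coe⟩ : ψ - φ ∈ ((↑) : ℝ → S1) '' Icc (-π) (-π + 2 * π) :=
    AddCircle.coe_image_Icc_eq (2 * π) (-π) ▸ mem_univ _
  obtain rfl : ψ = φ + (t : S1) := by rw [ht_coe, add_sub_cancel]
  rw [neg_add_eq_sub, two_mul, add_sub_cancel_right] at ht
  rcases (h.dist_eq_iff φ t ht).mp hψ with rfl | rfl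
  · exact Or.inl rfl
  · exact Or.inr rfl

theorem sphere_inter_range (h : IsIntersectionPair γ r a b) (φ : S1) :
    Metric.sphere (γ φ) r ∩ range γ = {γ (displace a φ), γ (displace b φ)} := by
  rw [← image_pair, ← h.setOf_dist_eq φ, inter_comm]
  exact image_preimage_eq_range_inter.symm

theorem left_inv (h : IsIntersectionPair γ r a b) :
    Function.LeftInverse (displace b) (displace a) := by
  intro φ
  have mem_pair := (h.setOf_dist_eq (displace a φ)).subset ((dist_comm _ _).trans (h.dist_a φ))
  refine (mem_pair.resolve_left fun h_double_step => ?_).symm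
  have sum_coe_eq_zero : ((a φ + a (displace a φ) : ℝ) : S1) = 0 := by
    rw [AddCircle.coe_add]
    exact left_eq_add.mp (h_double_step.trans (add_assoc _ _ _))
  have ha := h.a_mem φ
  have ha' := h.a_mem (displace a φ)
  rw [AddCircle.coe_eq_zero_iff_of_mem_Ico ⟨by linarith [ha.1, ha'.1], by linarith [ha.2, ha'.2]⟩]
    at sum_coe_eq_zero
  linarith [ha.1, ha'.1]

theorem right_inv (h : IsIntersectionPair γ r a b) :
    Function.RightInverse (displace b) (displace a) := by
  intro φ
  have mem_pair := (h.setOf_dist_eq (displace b φ)).subset ((dist_comm _ _).trans (h.dist_b φ))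
  refine (mem_pair.resolve_right fun h_double_step => ?_).symm
  have neg_sum_coe_eq_zero : ((-(b φ + b (displace b φ)) : ℝ) : S1) = 0 := by
    rw [AddCircle.coe_neg, AddCircle.coe_add, neg_eq_zero]
    exact left_eq_add.mp (h_double_step.trans (add_assoc _ _ _))
  have hb := h.b_mem φ
  have hb' := h.b_mem (displace b φ)
  rw [AddCircle.coe_eq_zero_iff_of_mem_Ico ⟨by linarith [hb.2, hb'.2], by linarith [hb.1, hb'.1]⟩]
    at neg_sum_coe_eq_zero
  linarith [hb.2, hb'.2]

theorem isNextParam {γ : S1 → Plane} (h : IsIntersectionPair γ r a b) (φ : S1) :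
    IsNextParam γ r φ (displace a φ) := by
  have ha := h.a_mem φ
  refine ⟨a φ, ⟨ha.1, by linarith [ha.2, Real.pi_pos]⟩, rfl, h.dist_a φ, fun s hs hdist => ?_⟩
  rcases (h.dist_eq_iff φ s ⟨by linarith [hs.1, Real.pi_pos], by linarith [hs.2, ha.2]⟩).mp hdist
    with rfl | rfl
  · exact lt_irrefl _ hs.2
  · exact lt_asymm hs.1 (h.b_mem φ).2

theorem isPrevParam {γ : S1 → Plane} (h : IsIntersectionPair γ r a b) (φ : S1) :
    IsPrevParam γ r φ (displace b φ) := by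
  have hb := h.b_mem φ
  refine ⟨-b φ, ⟨neg_pos.mpr hb.2, by linarith [hb.1, Real.pi_pos]⟩, ?_, h.dist_b φ,
    fun s hs hdist => ?_⟩
  · rw [AddCircle.coe_neg, sub_neg_eq_add, displace]
  · rw [sub_eq_add_neg, ← AddCircle.coe_neg] at hdist
    rcases (h.dist_eq_iff φ (-s) ⟨by linarith [hs.2, hb.1], by linarith [hs.1, Real.pi_pos]⟩).mp
      hdist with hs_eq | hs_eq
    · linarith [hs.1, (h.a_mem φ).1]
    · linarith [hs.2]

end IsIntersectionPair

end IntersectionPair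

section Stability

variable {H : Type*} [NormedAddCommGroup H] [InnerProductSpace ℝ H]

theorem continuous_radialSpeed :
    Continuous fun z : Ck (n + 1) H × S1 × S1 => radialSpeed z.1 z.2.1 z.2.2 := by
  have continuous_deriv : Continuous fun z : Ck (n + 1) H × S1 × S1 => Ck.D z.1 z.2.2 :=
    Ck.continuous_eval.comp ((Ck.D.continuous.comp continuous_fst).prodMk
      (continuous_snd.comp continuous_snd))
  refine continuous_deriv.inner (.sub ?_ ?_)
  · exact Ck.continuous_eval.comp (continuous_fst.prodMk (continuous_snd.comp continuous_snd))
  · exact Ck.continuous_eval.comp (continuous_fst.prodMk (continuous_fst.comp continuous_snd))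

theorem exists_radialSpeed_eq_zero (γ : Ck (n + 1) H) (φ : S1) {s t : ℝ} (hst : s < t)
    (hdist : dist (γ (φ + (s : S1))) (γ φ) = dist (γ (φ + (t : S1))) (γ φ)) :
    ∃ u ∈ Ioo s t, radialSpeed γ φ (φ + (u : S1)) = 0 := by
  have hasDerivAt_norm_sq (u : ℝ) : HasDerivAt (fun u : ℝ => ‖γ (φ + (u : S1)) - γ φ‖ ^ 2)
      (2 * inner ℝ (γ (φ + (u : S1)) - γ φ) (Ck.D γ (φ + (u : S1)))) u :=
    ((γ.hasDerivAt_add_coe φ u).sub_const (γ φ)).norm_sq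
  obtain ⟨u, hu, h_deriv⟩ := exists_hasDerivAt_eq_zero hst
    (fun u _ => (hasDerivAt_norm_sq u).continuousAt.continuousWithinAt)
    (by simp only [← dist_eq_norm, hdist]) fun u _ => hasDerivAt_norm_sq u
  rw [real_inner_comm] at h_deriv
  exact ⟨u, hu, (mul_eq_zero.mp h_deriv).resolve_left two_ne_zero⟩

theorem continuousAt_eval_of_continuousAt {X : Type*} [TopologicalSpace X] {T : X → Ck k E} {x₀ : X}
    (hT : ContinuousAt T x₀) (φ₀ : S1) :
    ContinuousAt (fun z : X × S1 => T z.1 z.2) (x₀, φ₀) :=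
  Ck.continuous_eval.continuousAt.comp
    ((ContinuousAt.comp hT continuousAt_fst).prodMk continuousAt_snd)

theorem continuousAt_displace {X : Type*} [TopologicalSpace X] {T : X → Ck k ℝ} {x₀ : X}
    (hT : ContinuousAt T x₀) (φ₀ : S1) :
    ContinuousAt (fun z : X × S1 => displace (T z.1) z.2) (x₀, φ₀) :=
  continuousAt_snd.add ((AddCircle.continuous_mk' _).continuousAt.comp
    (continuousAt_eval_of_continuousAt hT φ₀))

theorem eventually_eq_of_dist_eq {r : ℝ} {T : Ck (n + 1) H → Ck k ℝ} {γ₀ : Ck (n + 1) H}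
    (hT : ContinuousAt T γ₀)
    (hdist : ∀ᶠ γ in 𝓝 γ₀, ∀ φ, dist (γ (displace (T γ) φ)) (γ φ) = r) {φ₀ : S1}
    (hspeed : radialSpeed γ₀ φ₀ (displace (T γ₀) φ₀) ≠ 0) :
    ∀ᶠ z : Ck (n + 1) H × S1 × ℝ in 𝓝 (γ₀, φ₀, T γ₀ φ₀),
      dist (z.1 (z.2.1 + (z.2.2 : S1))) (z.1 z.2.1) = r → z.2.2 = T z.1 z.2.1 := by
  have eventually_speed_ne : ∀ᶠ z : Ck (n + 1) H × S1 × ℝ in 𝓝 (γ₀, φ₀, T γ₀ φ₀),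
      radialSpeed z.1 z.2.1 (z.2.1 + (z.2.2 : S1)) ≠ 0 := by
    have h_cont : Continuous fun z : Ck (n + 1) H × S1 × ℝ =>
        radialSpeed z.1 z.2.1 (z.2.1 + (z.2.2 : S1)) :=
      continuous_radialSpeed.comp (continuous_fst.prodMk
        ((continuous_fst.comp continuous_snd).prodMk ((continuous_fst.comp continuous_snd).add
          ((AddCircle.continuous_mk' _).comp (continuous_snd.comp continuous_snd)))))
    exact h_cont.continuousAt.eventually_ne hspeed
  obtain ⟨ε, hε, speed_ne⟩ := Metric.eventually_nhds_iff_ball.mp eventually_speed_ne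
  have h_branch : ContinuousAt (fun z : Ck (n + 1) H × S1 × ℝ => T z.1 z.2.1)
      (γ₀, φ₀, T γ₀ φ₀) :=
    ContinuousAt.comp (f := fun z : Ck (n + 1) H × S1 × ℝ => (z.1, z.2.1))
      (x := (γ₀, φ₀, T γ₀ φ₀)) (continuousAt_eval_of_continuousAt hT φ₀)
      (continuousAt_fst.prodMk (continuous_fst.comp continuous_snd).continuousAt)
  filter_upwards [Metric.ball_mem_nhds _ hε, h_branch.eventually (Metric.ball_mem_nhds _ hε),
    continuousAt_fst.eventually hdist] with ⟨γ, φ, t⟩ hz h_branch_mem hγ h_dist_t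
  rw [← ball_prod_same, ← ball_prod_same] at hz
  have speed_ne_between {s s' u : ℝ} (hs : s ∈ Metric.ball (T γ₀ φ₀) ε)
      (hs' : s' ∈ Metric.ball (T γ₀ φ₀) ε) (hu : u ∈ Ioo s s') :
      radialSpeed γ φ (φ + (u : S1)) ≠ 0 := by
    refine speed_ne (γ, φ, u) ?_
    rw [← ball_prod_same, ← ball_prod_same]
    exact ⟨hz.1, hz.2.1, (convex_ball _ _).ordConnected.out hs hs' (Ioo_subset_Icc_self hu)⟩
  rcases lt_trichotomy t (T γ φ) with hlt | heq | hgt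
  · obtain ⟨u, hu, hu_zero⟩ := exists_radialSpeed_eq_zero γ φ hlt (h_dist_t.trans (hγ φ).symm)
    exact absurd hu_zero (speed_ne_between hz.2.2 h_branch_mem hu)
  · exact heq
  · obtain ⟨u, hu, hu_zero⟩ := exists_radialSpeed_eq_zero γ φ hgt ((hγ φ).trans h_dist_t.symm)
    exact absurd hu_zero (speed_ne_between h_branch_mem hz.2.2 hu)

theorem eventually_forall_of_forall_eventually {X Y : Type*} [TopologicalSpace X]
    [TopologicalSpace Y] [CompactSpace Y] {x₀ : X} {p : X → Y → Prop}
    (h : ∀ y, ∀ᶠ z : X × Y in 𝓝 (x₀, y), p z.1 z.2) : ∀ᶠ x in 𝓝 x₀, ∀ y, p x y := by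
  simpa only [mem_univ, forall_true_left] using
    isCompact_univ.eventually_forall_of_forall_eventually fun y _ => h y

theorem eventually_eq_or_eq_of_dist_eq {r : ℝ} {A B : Ck (n + 1) H → Ck k ℝ} {γ₀ : Ck (n + 1) H}
    (hA : ContinuousAt A γ₀) (hB : ContinuousAt B γ₀)
    (hA_dist : ∀ᶠ γ in 𝓝 γ₀, ∀ φ, dist (γ (displace (A γ) φ)) (γ φ) = r)
    (hB_dist : ∀ᶠ γ in 𝓝 γ₀, ∀ φ, dist (γ (displace (B γ) φ)) (γ φ) = r)
    (h₀ : IsIntersectionPair γ₀ r (A γ₀) (B γ₀)) :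
    ∀ᶠ γ in 𝓝 γ₀, ∀ φ, ∀ t ∈ Icc (-π) π,
      dist (γ (φ + (t : S1))) (γ φ) = r → t = A γ φ ∨ t = B γ φ := by
  have continuous_dist : Continuous fun z : Ck (n + 1) H × S1 × ℝ =>
      dist (z.1 (z.2.1 + (z.2.2 : S1))) (z.1 z.2.1) := by
    refine .dist (Ck.continuous_eval.comp (continuous_fst.prodMk ?_))
      (Ck.continuous_eval.comp (continuous_fst.prodMk (continuous_fst.comp continuous_snd)))
    exact (continuous_fst.comp continuous_snd).add
      ((AddCircle.continuous_mk' _).comp (continuous_snd.comp continuous_snd))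
  have eventually_on_compact := (isCompact_univ.prod (isCompact_Icc (a := -π) (b := π))
    ).eventually_forall_of_forall_eventually (x₀ := γ₀) (P := fun γ q =>
      dist (γ (q.1 + (q.2 : S1))) (γ q.1) = r → q.2 = A γ q.1 ∨ q.2 = B γ q.1) ?_
  · filter_upwards [eventually_on_compact] with γ hγ φ t ht using hγ (φ, t) ⟨mem_univ φ, ht⟩
  rintro ⟨φ₀, t₀⟩ ⟨-, ht₀⟩
  by_cases h_dist : dist (γ₀ (φ₀ + (t₀ : S1))) (γ₀ φ₀) = r
  · rcases (h₀.dist_eq_iff φ₀ t₀ ht₀).mp h_dist with rfl | rfl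
    · filter_upwards [eventually_eq_of_dist_eq hA hA_dist (h₀.radialSpeed_a_ne φ₀)]
        with z hz h_eq using Or.inl (hz h_eq)
    · filter_upwards [eventually_eq_of_dist_eq hB hB_dist (h₀.radialSpeed_b_ne φ₀)]
        with z hz h_eq using Or.inr (hz h_eq)
  · filter_upwards [continuous_dist.continuousAt.eventually_ne h_dist] with z hz h_eq
      using absurd h_eq hz

theorem continuousAt_apply_displace {T : Ck n E → Ck k ℝ} {γ₀ : Ck n E} (hT : ContinuousAt T γ₀)
    (φ₀ : S1) : ContinuousAt (fun z : Ck n E × S1 => z.1 (displace (T z.1) z.2)) (γ₀, φ₀) :=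
  Ck.continuous_eval.continuousAt.comp (continuousAt_fst.prodMk (continuousAt_displace hT φ₀))

theorem eventually_radialSpeed_displace_ne {T : Ck (n + 1) H → Ck k ℝ} {γ₀ : Ck (n + 1) H}
    (hT : ContinuousAt T γ₀) (h₀ : ∀ φ, radialSpeed γ₀ φ (displace (T γ₀) φ) ≠ 0) :
    ∀ᶠ γ : Ck (n + 1) H in 𝓝 γ₀, ∀ φ, radialSpeed γ φ (displace (T γ) φ) ≠ 0 := by
  refine eventually_forall_of_forall_eventually fun φ => ?_
  have continuousAt_speed : ContinuousAt
      (fun z : Ck (n + 1) H × S1 => radialSpeed z.1 z.2 (displace (T z.1) z.2)) (γ₀, φ) :=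
    ContinuousAt.comp (f := fun z : Ck (n + 1) H × S1 => (z.1, z.2, displace (T z.1) z.2))
      continuous_radialSpeed.continuousAt
      (continuousAt_fst.prodMk (continuousAt_snd.prodMk (continuousAt_displace hT φ)))
  exact continuousAt_speed.eventually_ne (h₀ φ)

theorem IsIntersectionPair.eventually {r : ℝ} {A B : Ck (n + 1) H → Ck k ℝ} {γ₀ : Ck (n + 1) H}
    (h₀ : IsIntersectionPair γ₀ r (A γ₀) (B γ₀))
    (hA : ContinuousAt A γ₀) (hB : ContinuousAt B γ₀)
    (hA_dist : ∀ᶠ γ in 𝓝 γ₀, ∀ φ, dist (γ (displace (A γ) φ)) (γ φ) = r)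
    (hB_dist : ∀ᶠ γ in 𝓝 γ₀, ∀ φ, dist (γ (displace (B γ) φ)) (γ φ) = r) :
    ∀ᶠ γ : Ck (n + 1) H in 𝓝 γ₀, IsIntersectionPair γ r (A γ) (B γ) := by
  have hA_mem : ∀ᶠ γ in 𝓝 γ₀, ∀ φ, A γ φ ∈ Ioo 0 π :=
    eventually_forall_of_forall_eventually fun φ =>
      (continuousAt_eval_of_continuousAt hA φ).eventually (isOpen_Ioo.mem_nhds (h₀.a_mem φ))
  have hB_mem : ∀ᶠ γ in 𝓝 γ₀, ∀ φ, B γ φ ∈ Ioo (-π) 0 :=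
    eventually_forall_of_forall_eventually fun φ =>
      (continuousAt_eval_of_continuousAt hB φ).eventually (isOpen_Ioo.mem_nhds (h₀.b_mem φ))
  have points_ne : ∀ᶠ γ in 𝓝 γ₀, ∀ φ, γ (displace (A γ) φ) ≠ γ (displace (B γ) φ) :=
    eventually_forall_of_forall_eventually fun φ =>
      ((continuousAt_apply_displace hA φ).ne_iff_eventually_ne
        (continuousAt_apply_displace hB φ)).mp (h₀.ne φ)
  filter_upwards [hA_mem, hB_mem, points_ne, hA_dist, hB_dist,
    eventually_eq_or_eq_of_dist_eq hA hB hA_dist hB_dist h₀,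
    eventually_radialSpeed_displace_ne hA h₀.radialSpeed_a_ne,
    eventually_radialSpeed_displace_ne hB h₀.radialSpeed_b_ne]
    with γ hA_mem hB_mem points_ne hA_dist hB_dist eq_or_eq speed_A_ne speed_B_ne
  refine ⟨hA_mem, hB_mem, fun φ t ht => ⟨eq_or_eq φ t ht, ?_⟩, points_ne, speed_A_ne, speed_B_ne⟩
  rintro (rfl | rfl)
  exacts [hA_dist φ, hB_dist φ]

end Stability

section Diffeomorphisms

theorem isCkMap_displace (a : Ck k ℝ) : IsCkMap k (displace a) :=
  ⟨fun x => x + a (x : S1), contDiff_add_coe a, fun _ => rfl⟩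

open Classical in
/-- The diffeomorphism `φ ↦ φ + a φ`, where `φ ↦ φ + b φ` is its inverse; a junk value, the
identity, if these two maps are not inverse to each other. -/
def Diff.ofDisplace (a b : Ck k ℝ) : Diff k :=
  if h : Function.LeftInverse (displace b) (displace a) ∧
      Function.RightInverse (displace b) (displace a) then
    ⟨⟨displace a, displace b, h.1, h.2⟩, isCkMap_displace a, isCkMap_displace b⟩
  else
    ⟨Equiv.refl S1, ⟨id, contDiff_id, fun _ => rfl⟩, ⟨id, contDiff_id, fun _ => rfl⟩⟩

theorem Diff.coe_ofDisplace {a b : Ck k ℝ}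
    (hl : Function.LeftInverse (displace b) (displace a))
    (hr : Function.RightInverse (displace b) (displace a)) :
    ⇑(Diff.ofDisplace a b).toEquiv = displace a := by
  rw [Diff.ofDisplace, dif_pos ⟨hl, hr⟩, Equiv.coe_fn_mk]

variable {X : Type*} [NormedAddCommGroup X] {P : X → Diff k} {T : X → Ck k ℝ} {x₀ : X}

theorem isLocalRep_sub (hP : ∀ᶠ x in 𝓝 x₀, ⇑(P x).toEquiv = displace (T x)) :
    IsLocalRep P x₀ fun x => T x - T x₀ := by
  refine ⟨sub_self _, ?_⟩
  filter_upwards [hP] with x hx φ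
  rw [hx, hP.self_of_nhds, Ck.sub_apply, AddCircle.coe_sub, displace, displace]
  abel

variable [NormedSpace ℝ X]

theorem diffContDiffAt_of_eq_displace {ℓ : ℕ}
    (hP : ∀ᶠ x in 𝓝 x₀, ⇑(P x).toEquiv = displace (T x)) (hT : ContDiffAt ℝ ℓ T x₀) :
    DiffContDiffAt ℓ P x₀ :=
  ⟨_, isLocalRep_sub hP, hT.sub contDiffAt_const⟩

theorem diffHasFDerivAt_of_eq_displace {T' : X →L[ℝ] Ck k ℝ}
    (hP : ∀ᶠ x in 𝓝 x₀, ⇑(P x).toEquiv = displace (T x)) (hT : HasFDerivAt T T' x₀) :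
    DiffHasFDerivAt P T' x₀ :=
  ⟨_, isLocalRep_sub hP, hT.sub_const _⟩

end Diffeomorphisms

section Circle

theorem circleCurve_coe (R x : ℝ) :
    circleCurve n R (x : S1) = !₂[R * Real.cos x, R * Real.sin x] := by
  change circleFun R (x : S1) = _
  exact Function.Periodic.lift_coe _ x

theorem angDeriv_one_circleCurve (R x : ℝ) :
    angDeriv 1 (circleCurve n R) (x : S1) = !₂[-(R * Real.sin x), R * Real.cos x] := by
  have hasDerivAt_coords : HasDerivAt (fun y : ℝ => ![R * Real.cos y, R * Real.sin y])
      ![-(R * Real.sin x), R * Real.cos x] x := by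
    refine hasDerivAt_pi.mpr (Fin.forall_fin_two.mpr ⟨?_, ?_⟩)
    · exact ((Real.hasDerivAt_cos x).const_mul R).congr_deriv (mul_neg _ _)
    · exact (Real.hasDerivAt_sin x).const_mul R
  have hasDerivAt_circle := (PiLp.continuousLinearEquiv 2 ℝ fun _ : Fin 2 => ℝ
    ).symm.hasFDerivAt.comp_hasDerivAt x hasDerivAt_coords
  rw [angDeriv_coe, iteratedDeriv_one, funext (circleCurve_coe R)]
  exact hasDerivAt_circle.deriv

theorem dist_sq_circleCurve_add (R : ℝ) (φ : S1) (t : ℝ) :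
    dist (circleCurve n R (φ + (t : S1))) (circleCurve n R φ) ^ 2 =
      2 * R ^ 2 * (1 - Real.cos t) := by
  induction φ using QuotientAddGroup.induction_on with
  | H x =>
    have h_coe : ((x : S1) + (t : S1)) = ((x + t : ℝ) : S1) := (AddCircle.coe_add _ x t).symm
    change dist (circleCurve n R ((x : S1) + (t : S1))) (circleCurve n R (x : S1)) ^ 2 = _
    rw [h_coe, circleCurve_coe, circleCurve_coe, EuclideanSpace.dist_sq_eq]
    simp only [Fin.sum_univ_two, Real.dist_eq, sq_abs, Matrix.cons_val_zero, Matrix.cons_val_one,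
      Real.cos_add, Real.sin_add]
    linear_combination
      R ^ 2 * (1 + (Real.sin t ^ 2 + Real.cos t ^ 2) - 2 * Real.cos t) *
        Real.sin_sq_add_cos_sq x + R ^ 2 * Real.sin_sq_add_cos_sq t

theorem radialSpeed_circleCurve (R : ℝ) (φ : S1) (t : ℝ) :
    radialSpeed (circleCurve n R) φ (φ + (t : S1)) = R ^ 2 * Real.sin t := by
  induction φ using QuotientAddGroup.induction_on with
  | H x =>
    have h_coe : ((x : S1) + (t : S1)) = ((x + t : ℝ) : S1) := (AddCircle.coe_add _ x t).symm
    change radialSpeed (circleCurve n R) (x : S1) ((x : S1) + (t : S1)) = _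
    rw [h_coe, radialSpeed, circleCurve_coe, circleCurve_coe, angDeriv_one_circleCurve,
      PiLp.inner_apply]
    simp only [Fin.sum_univ_two, PiLp.sub_apply, Matrix.cons_val_zero, Matrix.cons_val_one,
      Real.cos_add, Real.sin_add, RCLike.inner_apply, conj_trivial]
    linear_combination R ^ 2 * Real.sin t * Real.sin_sq_add_cos_sq x

theorem exists_chord_angle {r R : ℝ} (hr : 0 < r) (hR : r / 2 < R) :
    ∃ α ∈ Ioo 0 π, 2 * R ^ 2 * (1 - Real.cos α) = r ^ 2 := by
  have hR_pos : 0 < R := (half_pos hr).trans hR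
  have ratio_pos : 0 < r / 2 / R := div_pos (half_pos hr) hR_pos
  have ratio_lt_one : r / 2 / R < 1 := (div_lt_one hR_pos).mpr hR
  refine ⟨2 * Real.arcsin (r / 2 / R), ⟨?_, ?_⟩, ?_⟩
  · linarith [Real.arcsin_pos.mpr ratio_pos]
  · linarith [Real.arcsin_lt_pi_div_two.mpr ratio_lt_one]
  · rw [Real.cos_two_mul, Real.cos_sq', Real.sin_arcsin (by linarith) ratio_lt_one.le]
    field_simp
    ring

theorem dist_circleCurve_add_eq_iff {r R α : ℝ} (hr : 0 < r) (hα : α ∈ Ioo 0 π)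
    (h_chord : 2 * R ^ 2 * (1 - Real.cos α) = r ^ 2) (φ : S1) {t : ℝ} (ht : t ∈ Icc (-π) π) :
    dist (circleCurve n R (φ + (t : S1))) (circleCurve n R φ) = r ↔ t = α ∨ t = -α := by
  have hR : 2 * R ^ 2 ≠ 0 := by
    intro h
    rw [h, zero_mul] at h_chord
    exact (pow_pos hr 2).ne h_chord
  have cos_abs_eq_iff : Real.cos |t| = Real.cos α ↔ |t| = α :=
    Real.injOn_cos.eq_iff ⟨abs_nonneg t, abs_le.mpr ht⟩ (Ioo_subset_Icc_self hα)
  rw [← sq_eq_sq₀ dist_nonneg hr.le, dist_sq_circleCurve_add, ← h_chord, mul_right_inj' hR,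
    sub_right_inj, ← Real.cos_abs, cos_abs_eq_iff, abs_eq hα.1.le]

theorem circleCurve_add_ne {R α : ℝ} (hR : R ≠ 0) (hα : Real.sin α ≠ 0) (φ : S1) :
    circleCurve n R (φ + (α : S1)) ≠ circleCurve n R (φ + ((-α : ℝ) : S1)) := by
  intro h_eq
  have two_arcs : φ + ((-α : ℝ) : S1) + ((2 * α : ℝ) : S1) = φ + (α : S1) := by
    rw [AddCircle.coe_neg, two_mul α, AddCircle.coe_add]
    abel
  have chord_sq := dist_sq_circleCurve_add (n := n) R (φ + ((-α : ℝ) : S1)) (2 * α)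
  rw [two_arcs, dist_eq_zero.mpr h_eq, Real.cos_two_mul, Real.cos_sq'] at chord_sq
  have : 0 < (R * Real.sin α) ^ 2 := sq_pos_of_ne_zero (mul_ne_zero hR hα)
  linarith

theorem exists_isIntersectionPair_circleCurve (k n : ℕ) {r R : ℝ} (hr : 0 < r) (hR : r / 2 < R) :
    ∃ a b : Ck k ℝ, IsIntersectionPair (circleCurve n R) r a b := by
  obtain ⟨α, hα, h_chord⟩ := exists_chord_angle hr hR
  have hR_pos : 0 < R := (half_pos hr).trans hR
  have sin_pos : 0 < Real.sin α := Real.sin_pos_of_mem_Ioo hα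
  have speed_ne : R ^ 2 * Real.sin α ≠ 0 := (mul_pos (pow_pos hR_pos 2) sin_pos).ne'
  refine ⟨Ck.const α, Ck.const (-α), fun _ => hα,
    fun _ => ⟨neg_lt_neg hα.2, neg_lt_zero.mpr hα.1⟩,
    fun φ t ht => dist_circleCurve_add_eq_iff hr hα h_chord φ ht,
    circleCurve_add_ne hR_pos.ne' sin_pos.ne',
    fun φ => (radialSpeed_circleCurve R φ α).trans_ne speed_ne,
    fun φ => (radialSpeed_circleCurve R φ (-α)).trans_ne ?_⟩
  rwa [Real.sin_neg, mul_neg, neg_ne_zero]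

end Circle

theorem exists_intersection_neighborhood {H : Type*} [NormedAddCommGroup H]
    [InnerProductSpace ℝ H] [CompleteSpace H] {ℓ : ℕ} (hℓ : 1 ≤ ℓ) (h : k + ℓ ≤ n) {r : ℝ}
    {γ₀ : Ck (n + 1) H} {a₀ b₀ : Ck k ℝ} (h₀ : IsIntersectionPair γ₀ r a₀ b₀) :
    ∃ (V : Set (Ck (n + 1) H)) (A B : Ck (n + 1) H → Ck k ℝ), IsOpen V ∧ γ₀ ∈ V ∧
      ∀ γ ∈ V, IsIntersectionPair γ r (A γ) (B γ) ∧ ContDiffAt ℝ ℓ A γ ∧ ContDiffAt ℝ ℓ B γ := by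
  obtain ⟨A, hA, rfl, hA_dist⟩ := exists_contDiffAt_dist_displace_eq hℓ h h₀.dist_a
    h₀.radialSpeed_a_ne
  obtain ⟨B, hB, rfl, hB_dist⟩ := exists_contDiffAt_dist_displace_eq hℓ h h₀.dist_b
    h₀.radialSpeed_b_ne
  have eventually_good := (h₀.eventually hA.continuousAt hB.continuousAt hA_dist hB_dist).and
    ((hA.eventually (by simp)).and (hB.eventually (by simp)))
  obtain ⟨V, hV, V_open, γ₀_mem⟩ := eventually_nhds_iff.mp eventually_good
  exact ⟨V, A, B, V_open, γ₀_mem, hV⟩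

end CircInv

end

open CircInv in
theorem mainTheorem4_general (k ℓ : ℕ) (hℓ : 1 ≤ ℓ) (r : ℝ) {γ₀ : Ck (k + ℓ + 1) Plane}
    {a₀ b₀ : Ck k ℝ} (h₀ : IsIntersectionPair γ₀ r a₀ b₀) :
    ∃ V : Set (Ck (k + ℓ + 1) Plane),
      IsOpen V ∧ γ₀ ∈ V ∧
      ∃ p m : Ck (k + ℓ + 1) Plane → Diff k,
        (∀ γ ∈ V, ∀ φ : S1,
          Metric.sphere (γ φ) r ∩ Set.range γ = {γ (p γ φ), γ (m γ φ)} ∧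
          γ (p γ φ) ≠ γ (m γ φ) ∧
          {ψ : S1 | dist (γ ψ) (γ φ) = r} = {p γ φ, m γ φ} ∧
          IsNextParam γ r φ (p γ φ) ∧
          IsPrevParam γ r φ (m γ φ)) ∧
        (∀ γ ∈ V, DiffContDiffAt ℓ p γ ∧ DiffContDiffAt ℓ m γ) ∧
        (∀ γ ∈ V, ∃ p' m' : Ck (k + ℓ + 1) Plane →L[ℝ] Ck k ℝ,
          DiffHasFDerivAt p p' γ ∧
          DiffHasFDerivAt m m' γ ∧
          ∀ φ : S1,
            inner ℝ (angDeriv 1 γ (p γ φ)) (γ (p γ φ) - γ φ) ≠ 0 ∧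
            inner ℝ (angDeriv 1 γ (m γ φ)) (γ (m γ φ) - γ φ) ≠ 0 ∧
            ∀ σ : Ck (k + ℓ + 1) Plane,
              p' σ φ = inner ℝ (σ φ - σ (p γ φ)) (γ (p γ φ) - γ φ) /
                inner ℝ (angDeriv 1 γ (p γ φ)) (γ (p γ φ) - γ φ) ∧
              m' σ φ = inner ℝ (σ φ - σ (m γ φ)) (γ (m γ φ) - γ φ) /
                inner ℝ (angDeriv 1 γ (m γ φ)) (γ (m γ φ) - γ φ)) := by
  obtain ⟨V, A, B, V_open, γ₀_mem, hV⟩ := exists_intersection_neighborhood hℓ le_rfl h₀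
  let p γ := Diff.ofDisplace (A γ) (B γ)
  let m γ := Diff.ofDisplace (B γ) (A γ)
  have p_eq : ∀ γ ∈ V, ⇑(p γ).toEquiv = displace (A γ) := fun γ hγ =>
    Diff.coe_ofDisplace (hV γ hγ).1.left_inv (hV γ hγ).1.right_inv
  have m_eq : ∀ γ ∈ V, ⇑(m γ).toEquiv = displace (B γ) := fun γ hγ =>
    Diff.coe_ofDisplace (hV γ hγ).1.right_inv (hV γ hγ).1.left_inv
  refine ⟨V, V_open, γ₀_mem, p, m, fun γ hγ φ => ?_, fun γ hγ => ?_, fun γ hγ => ?_⟩ <;>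
    obtain ⟨pair, hA, hB⟩ := hV γ hγ <;>
    have V_mem := V_open.mem_nhds hγ
  · rw [p_eq γ hγ, m_eq γ hγ]
    exact ⟨pair.sphere_inter_range φ, pair.ne φ, pair.setOf_dist_eq φ, pair.isNextParam φ,
      pair.isPrevParam φ⟩
  · exact ⟨diffContDiffAt_of_eq_displace (eventually_of_mem V_mem p_eq) hA,
      diffContDiffAt_of_eq_displace (eventually_of_mem V_mem m_eq) hB⟩
  · have ℓ_ne : (ℓ : WithTop ℕ∞) ≠ 0 := by exact_mod_cast (Nat.one_le_iff_ne_zero.mp hℓ)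
    have hA' := hA.differentiableAt ℓ_ne
    have hB' := hB.differentiableAt ℓ_ne
    refine ⟨fderiv ℝ A γ, fderiv ℝ B γ,
      diffHasFDerivAt_of_eq_displace (eventually_of_mem V_mem p_eq) hA'.hasFDerivAt,
      diffHasFDerivAt_of_eq_displace (eventually_of_mem V_mem m_eq) hB'.hasFDerivAt, fun φ => ?_⟩
    rw [p_eq γ hγ, m_eq γ hγ]
    refine ⟨pair.radialSpeed_a_ne φ, pair.radialSpeed_b_ne φ, fun σ => ⟨?_, ?_⟩⟩
    · exact fderiv_apply_of_dist_displace_eq (by omega) hA'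
        (eventually_of_mem V_mem fun x hx => (hV x hx).1.dist_a) (pair.radialSpeed_a_ne φ) σ
    · exact fderiv_apply_of_dist_displace_eq (by omega) hB'
        (eventually_of_mem V_mem fun x hx => (hV x hx).1.dist_b) (pair.radialSpeed_b_ne φ) σ

theorem mainTheorem4 (k ℓ : ℕ) (hℓ : 1 ≤ ℓ) (r R : ℝ) (hr : 0 < r) (hR : r / 2 < R) :
    ∃ V : Set (CircInv.Ck (k + ℓ + 1) CircInv.Plane),
      IsOpen V ∧ CircInv.circleCurve (k + ℓ + 1) R ∈ V ∧
      ∃ p m : CircInv.Ck (k + ℓ + 1) CircInv.Plane → CircInv.Diff k,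
        (∀ γ ∈ V, ∀ φ : CircInv.S1,
          Metric.sphere (γ φ) r ∩ Set.range γ = {γ (p γ φ), γ (m γ φ)} ∧
          γ (p γ φ) ≠ γ (m γ φ) ∧
          {ψ : CircInv.S1 | dist (γ ψ) (γ φ) = r} = {p γ φ, m γ φ} ∧
          CircInv.IsNextParam γ r φ (p γ φ) ∧
          CircInv.IsPrevParam γ r φ (m γ φ)) ∧
        (∀ γ ∈ V, CircInv.DiffContDiffAt ℓ p γ ∧ CircInv.DiffContDiffAt ℓ m γ) ∧
        (∀ γ ∈ V, ∃ p' m' : CircInv.Ck (k + ℓ + 1) CircInv.Plane →L[ℝ] CircInv.Ck k ℝ,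
          CircInv.DiffHasFDerivAt p p' γ ∧
          CircInv.DiffHasFDerivAt m m' γ ∧
          ∀ φ : CircInv.S1,
            inner ℝ (CircInv.angDeriv 1 γ (p γ φ)) (γ (p γ φ) - γ φ) ≠ 0 ∧
            inner ℝ (CircInv.angDeriv 1 γ (m γ φ)) (γ (m γ φ) - γ φ) ≠ 0 ∧
            ∀ σ : CircInv.Ck (k + ℓ + 1) CircInv.Plane,
              p' σ φ = inner ℝ (σ φ - σ (p γ φ)) (γ (p γ φ) - γ φ) /
                inner ℝ (CircInv.angDeriv 1 γ (p γ φ)) (γ (p γ φ) - γ φ) ∧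
              m' σ φ = inner ℝ (σ φ - σ (m γ φ)) (γ (m γ φ) - γ φ) /
                inner ℝ (CircInv.angDeriv 1 γ (m γ φ)) (γ (m γ φ) - γ φ)) :=
  let ⟨_, _, h₀⟩ := CircInv.exists_isIntersectionPair_circleCurve k (k + ℓ + 1) hr hR
  mainTheorem4_general k ℓ hℓ r h₀
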